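/- Let $n\ge 1$ and let $\mathbb{Z}_2^n=\{0,1\}^n$ be the Hamming cube, with the Hamming metric $d(x,y)=|\{i: x_i\ne y_i\}|$ and any base point $O\in\mathbb{Z}_2^n$. Let $\operatorname{Lip}_0(\mathbb{Z}_2^n)$ be the space of all functions $f:\mathbb{Z}_2^n\to\mathbb{R}$ with $f(O)=0$, normed by the Lipschitz constant $\|f\|=\max_{x\ne y}|f(x)-f(y)|/d(x,y)$. For a finite-dimensional real normed space $Y$, the projection constant is $$\lambda(Y)=\inf\{\|P\| : P:\ell_\infty\to\ell_\infty \text{ is a bounded linear projection with range } Y_1\},$$ where $Y_1$ is any subspace of the real sequence space $\ell_\infty$ that is linearly isometric to $Y$ (such subspaces exist, and the value does not depend on the choice of $Y_1$). Then $$\lambda(\operatorname{Lip}_0(\mathbb{Z}_2^n))=\frac{n+1}{2}.$$ -/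

import Mathlib

open scoped ENNReal

/-- The real vector space of all Lipschitz functions `f : X → ℝ` with `f O = 0`, for a metric
space `X` with base point `O`. -/
def lipZeroSubmodule (X : Type*) [MetricSpace X] (O : X) : Submodule ℝ (X → ℝ) where
  carrier := {f | (∃ K : NNReal, LipschitzWith K f) ∧ f O = 0}
  add_mem' := by
    rintro f g ⟨⟨K, hK⟩, hf⟩ ⟨⟨L, hL⟩, hg⟩
    exact ⟨⟨K + L, hK.add hL⟩, by simp [hf, hg]⟩
  zero_mem' := ⟨⟨0, LipschitzWith.const (0 : ℝ)⟩, rfl⟩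
  smul_mem' := by
    rintro c f ⟨⟨K, hK⟩, hf⟩
    refine ⟨⟨‖c‖₊ * K, ?_⟩, by simp [hf]⟩
    exact (lipschitzWith_smul c).comp hK

/-- `LipZero X O` is the space `Lip₀(X)` of the pointed metric space `(X, O)`. It is a type of its
own, so that its only norm is the Lipschitz norm defined below. -/
def LipZero (X : Type*) [MetricSpace X] (O : X) : Type _ := ↥(lipZeroSubmodule X O)

namespace LipZero

variable {X : Type*} [MetricSpace X] {O : X}

instance : AddCommGroup (LipZero X O) := inferInstanceAs (AddCommGroup ↥(lipZeroSubmodule X O))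

noncomputable instance : Module ℝ (LipZero X O) :=
  inferInstanceAs (Module ℝ ↥(lipZeroSubmodule X O))

/-- The underlying function of an element of `Lip₀(X)`. -/
def toFun (f : LipZero X O) : X → ℝ := f.1

/-- The Lipschitz constant `sup |f x - f y| / d(x, y)`; the pairs with `x = y` contribute
`0 / 0 = 0` and so do not change the supremum. -/
noncomputable instance : Norm (LipZero X O) :=
  ⟨fun f => ⨆ p : X × X, |f.toFun p.1 - f.toFun p.2| / dist p.1 p.2⟩

theorem norm_def (f : LipZero X O) :
    ‖f‖ = ⨆ p : X × X, |f.toFun p.1 - f.toFun p.2| / dist p.1 p.2 := rfl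

theorem toFun_add (f g : LipZero X O) (x : X) : (f + g).toFun x = f.toFun x + g.toFun x := rfl

theorem toFun_smul (c : ℝ) (f : LipZero X O) (x : X) : (c • f).toFun x = c * f.toFun x := rfl

theorem toFun_base (f : LipZero X O) : f.toFun O = 0 := f.2.2

theorem bddAbove (f : LipZero X O) :
    BddAbove (Set.range fun p : X × X => |f.toFun p.1 - f.toFun p.2| / dist p.1 p.2) := by
  obtain ⟨K, hK⟩ := f.2.1
  refine ⟨K, ?_⟩
  rintro _ ⟨p, rfl⟩
  refine div_le_of_le_mul₀ dist_nonneg K.2 ?_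
  have h := hK.dist_le_mul p.1 p.2
  rwa [Real.dist_eq] at h

theorem norm_nonneg' (f : LipZero X O) : 0 ≤ ‖f‖ :=
  Real.iSup_nonneg fun _ => div_nonneg (abs_nonneg _) dist_nonneg

theorem abs_sub_le (f : LipZero X O) (x y : X) :
    |f.toFun x - f.toFun y| ≤ ‖f‖ * dist x y := by
  rcases eq_or_ne x y with rfl | hxy
  · simp
  · exact (div_le_iff₀ (dist_pos.2 hxy)).1 (le_ciSup f.bddAbove (x, y))

theorem norm_le (f : LipZero X O) {C : ℝ} (hC : 0 ≤ C)
    (h : ∀ x y, |f.toFun x - f.toFun y| ≤ C * dist x y) : ‖f‖ ≤ C := by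
  have : Nonempty (X × X) := ⟨(O, O)⟩
  exact ciSup_le fun p => div_le_of_le_mul₀ dist_nonneg hC (h p.1 p.2)

theorem norm_smul' (c : ℝ) (f : LipZero X O) : ‖c • f‖ = |c| * ‖f‖ := by
  rw [norm_def, norm_def, Real.mul_iSup_of_nonneg (abs_nonneg c)]
  congr 1
  ext p
  rw [toFun_smul, toFun_smul, ← mul_sub, abs_mul, mul_div_assoc]

theorem norm_core : NormedSpace.Core ℝ (LipZero X O) where
  norm_nonneg := norm_nonneg'
  norm_smul c f := norm_smul' c f
  norm_triangle f g := by
    refine norm_le _ (add_nonneg (norm_nonneg' f) (norm_nonneg' g)) fun x y => ?_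
    rw [toFun_add, toFun_add, add_sub_add_comm, add_mul]
    exact (abs_add_le _ _).trans (add_le_add (abs_sub_le f x y) (abs_sub_le g x y))
  norm_eq_zero_iff f := by
    constructor
    · intro h
      refine Subtype.ext (funext fun x => ?_)
      have h1 := abs_sub_le f x O
      rw [h, zero_mul, toFun_base, sub_zero] at h1
      exact abs_nonpos_iff.1 h1
    · rintro rfl
      have h := norm_smul' (0 : ℝ) (0 : LipZero X O)
      simpa using h

noncomputable instance : NormedAddCommGroup (LipZero X O) := NormedAddCommGroup.ofCore norm_core

noncomputable instance : NormedSpace ℝ (LipZero X O) := NormedSpace.ofCore norm_core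

end LipZero

/-- The real Banach space `ℓ_∞` of bounded real sequences with the supremum norm. -/
abbrev EllInfty : Type := lp (fun _ : ℕ => ℝ) ∞

/-- `P` is a (bounded linear) projection of `ℓ_∞` with range `Y₁`. -/
def IsProjectionOnto (P : EllInfty →L[ℝ] EllInfty) (Y₁ : Submodule ℝ EllInfty) : Prop :=
  P ∘L P = P ∧ LinearMap.range (P : EllInfty →ₗ[ℝ] EllInfty) = Y₁

/-- `HasProjectionConstant Y c` says that the projection constant `λ(Y)` of the
(finite-dimensional) normed space `Y` is `c`: there are subspaces of `ℓ_∞` linearly isometric to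
`Y`, and whichever such subspace `Y₁` is taken, `c` is the infimum of the norms of the projections
of `ℓ_∞` with range `Y₁`. (A real number is a greatest lower bound of a nonempty set only, so the
existence of such projections is included.) -/
def HasProjectionConstant (Y : Type*) [NormedAddCommGroup Y] [NormedSpace ℝ Y] (c : ℝ) : Prop :=
  (∃ Y₁ : Submodule ℝ EllInfty, Nonempty (Y ≃ₗᵢ[ℝ] Y₁)) ∧
    ∀ Y₁ : Submodule ℝ EllInfty, Nonempty (Y ≃ₗᵢ[ℝ] Y₁) →
      IsGLB {r : ℝ | ∃ P : EllInfty →L[ℝ] EllInfty, IsProjectionOnto P Y₁ ∧ r = ‖P‖} c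

/-- The Hamming cube `ℤ₂ⁿ` with the Hamming metric (the number of coordinates in which two points
differ), that is, the graph metric of the `n`-dimensional cube. -/
abbrev HammingCube (n : ℕ) : Type := Hamming fun _ : Fin n => ZMod 2

/-!
`Lip₀` of the cube embeds isometrically, by the discrete gradient `edgeDiff`, into the space of
functions on the directed edges with the maximum norm. Finite powers of `ℝ` and `ℓ_∞` are
`1`-injective (the Hahn–Banach theorem, coordinate by coordinate), so the projection constant is the
least norm of a left inverse of this one embedding: `hasProjectionConstant_of_leftInverse`.

For the upper bound, the left inverse `edgePotential` is the one for which
`edgeDiff ∘ edgePotential` is the orthogonal projection onto the gradients. Its kernel is an integral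
over `r ∈ [0, 1]` of the products `∏ (1 ± r)` that form the heat kernel of the cube. That it inverts
the gradient is the fundamental theorem of calculus (`sum_cubeKernel`). The integrands are
nonnegative up to an explicit sign, so the sum of the absolute values in a row of the projection can
be computed: the edges parallel to the given one contribute `1`, and each of the other `n - 1`
directions contributes `1 / 2` (`sum_abs_cubeKernel_sub`).

For the lower bound, let `S` be the matrix of the signs of this projection. It maps gradients to
gradients, so the trace of `edgeDiff ∘ Q ∘ S` is the same for every left inverse `Q`. The value
of this trace is `(n + 1) / 2` times the number of directed edges (`sum_edgeDiff_edgeSign`), while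
each diagonal entry is at most `‖Q‖`. In the formal proof the invariance of the trace takes the form
of `sum_edgeSign_eq`: the columns of `S` that belong to the edges at one vertex add up to a gradient.
-/

/-! ### The Hamming cube and its edges -/

/-- Reversal of the `i`-th coordinate, an involution of the Hamming cube. -/
def cubeFlip {n : ℕ} (i : Fin n) : HammingCube n ≃ HammingCube n :=
  Function.Involutive.toPerm
    (fun x => Hamming.toHamming
      (Function.update (Hamming.ofHamming x) i (Hamming.ofHamming x i + 1))) <| by
    intro x
    have h2 : ∀ a : ZMod 2, a + 1 + 1 = a := by decide
    refine Hamming.ofHamming.injective (funext fun k => ?_)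
    by_cases h : k = i
    · subst h
      simpa using h2 _
    · simp [h]

theorem ofHamming_cubeFlip {n : ℕ} (i : Fin n) (x : HammingCube n) :
    Hamming.ofHamming (cubeFlip i x) =
      Function.update (Hamming.ofHamming x) i (Hamming.ofHamming x i + 1) := rfl

theorem cubeFlip_cubeFlip {n : ℕ} (i : Fin n) (x : HammingCube n) :
    cubeFlip i (cubeFlip i x) = x :=
  (cubeFlip i).left_inv x

theorem dist_cubeFlip {n : ℕ} (i : Fin n) (x : HammingCube n) : dist x (cubeFlip i x) = 1 := by
  rw [Hamming.dist_eq_hammingDist, ofHamming_cubeFlip, hammingDist]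
  have h2 : ∀ a : ZMod 2, a ≠ a + 1 := by decide
  have : (Finset.univ.filter fun k => Hamming.ofHamming x k ≠
      Function.update (Hamming.ofHamming x) i (Hamming.ofHamming x i + 1) k) = {i} := by
    ext k
    by_cases h : k = i
    · subst h
      simp [h2]
    · simp [h]
  rw [this]
  simp

theorem sum_eq_zero_of_cubeFlip {n : ℕ} (i : Fin n) {F : HammingCube n → ℝ}
    (h : ∀ x, F (cubeFlip i x) = -F x) : ∑ x, F x = 0 := by
  have h1 := Equiv.sum_comp (cubeFlip i) F
  simp only [h, Finset.sum_neg_distrib] at h1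
  linarith

/-- The Hamming metric is the graph metric of the cube, so a function whose increments along the
edges are at most `C` is `C`-Lipschitz. -/
theorem abs_sub_le_of_cubeFlip {n : ℕ} {f : HammingCube n → ℝ} {C : ℝ}
    (h : ∀ i x, |f x - f (cubeFlip i x)| ≤ C) (x y : HammingCube n) :
    |f x - f y| ≤ C * dist x y := by
  rw [Hamming.dist_eq_hammingDist]
  generalize hd : hammingDist (Hamming.ofHamming x) (Hamming.ofHamming y) = d
  induction d generalizing x with
  | zero =>
    have : x = y := hammingDist_eq_zero.1 hd
    simp [this]
  | succ d ih =>
    have hne : Hamming.ofHamming x ≠ Hamming.ofHamming y := by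
      rw [← hammingDist_ne_zero, hd]
      exact d.succ_ne_zero
    obtain ⟨i, hi⟩ := Function.ne_iff.1 hne
    have h2 : ∀ a b : ZMod 2, a ≠ b → a + 1 = b := by decide
    have hd' : hammingDist (Hamming.ofHamming (cubeFlip i x)) (Hamming.ofHamming y) = d := by
      rw [hammingDist] at hd ⊢
      have : (Finset.univ.filter fun k => Hamming.ofHamming (cubeFlip i x) k ≠
          Hamming.ofHamming y k) =
          (Finset.univ.filter fun k => Hamming.ofHamming x k ≠ Hamming.ofHamming y k).erase i := by
        ext k
        rw [Finset.mem_filter, Finset.mem_erase, Finset.mem_filter]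
        by_cases hk : k = i
        · subst hk
          simpa [ofHamming_cubeFlip] using h2 _ _ hi
        · simp [ofHamming_cubeFlip, hk]
      rw [this, Finset.card_erase_of_mem (by simpa using hi), hd]
      rfl
    have h3 := abs_sub_le (f x) (f (cubeFlip i x)) (f y)
    have h4 := h i x
    have h5 := ih _ hd'
    push_cast
    linarith

/-- The sign `(-1) ^ (x k + y k)`: it is `1` if `x` and `y` agree in the coordinate `k`, and `-1`
otherwise. -/
def relSign {n : ℕ} (x y : HammingCube n) (k : Fin n) : ℝ :=
  if Hamming.ofHamming x k = Hamming.ofHamming y k then 1 else -1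

theorem relSign_comm {n : ℕ} (x y : HammingCube n) : relSign x y = relSign y x := by
  funext k
  simp [relSign, eq_comm]

theorem relSign_self {n : ℕ} (x : HammingCube n) (k : Fin n) : relSign x x k = 1 := by
  simp [relSign]

theorem relSign_mul_self {n : ℕ} (x y : HammingCube n) (k : Fin n) :
    relSign x y k * relSign x y k = 1 := by
  unfold relSign
  split_ifs <;> norm_num

theorem abs_relSign {n : ℕ} (x y : HammingCube n) (k : Fin n) : |relSign x y k| = 1 := by
  unfold relSign
  split_ifs <;> norm_num

theorem relSign_cubeFlip_left {n : ℕ} (i : Fin n) (x y : HammingCube n) :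
    relSign (cubeFlip i x) y = Function.update (relSign x y) i (-relSign x y i) := by
  have h2 : ∀ a b : ZMod 2, a + 1 = b ↔ ¬ a = b := by decide
  funext k
  by_cases hk : k = i
  · subst hk
    simp only [relSign, ofHamming_cubeFlip, Function.update_self, h2]
    split_ifs <;> simp
  · simp [relSign, ofHamming_cubeFlip, hk]

theorem relSign_cubeFlip_right {n : ℕ} (i : Fin n) (x y : HammingCube n) :
    relSign x (cubeFlip i y) = Function.update (relSign x y) i (-relSign x y i) := by
  rw [relSign_comm, relSign_cubeFlip_left, relSign_comm]

theorem prod_one_add_relSign {n : ℕ} (x y : HammingCube n) :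
    ∏ k, (1 + relSign x y k) = if x = y then 2 ^ n else 0 := by
  split_ifs with h
  · subst h
    simp only [relSign_self]
    norm_num
  · have hne : Hamming.ofHamming x ≠ Hamming.ofHamming y := h
    obtain ⟨i, hi⟩ := Function.ne_iff.1 hne
    exact Finset.prod_eq_zero (Finset.mem_univ i) (by simp [relSign, hi])

theorem card_hammingCube (n : ℕ) : Fintype.card (HammingCube n) = 2 ^ n := by
  rw [← Fintype.card_congr (Hamming.toHamming (β := fun _ : Fin n => ZMod 2))]
  simp

theorem sum_prod_one_add_relSign_mul {n : ℕ} (y : HammingCube n) (A : Finset (Fin n)) (r : ℝ) :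
    ∑ x, ∏ k ∈ A, (1 + relSign x y k * r) = 2 ^ n := by
  induction A using Finset.induction_on with
  | empty => simp [card_hammingCube]
  | insert a A ha ih =>
    simp only [Finset.prod_insert ha, add_mul, one_mul, Finset.sum_add_distrib, ih]
    rw [sum_eq_zero_of_cubeFlip a, add_zero]
    intro x
    rw [relSign_cubeFlip_left, Function.update_self, Finset.prod_congr rfl (fun k hk => by
      rw [Function.update_of_ne (ne_of_mem_of_not_mem hk ha)])]
    ring

/-! ### The kernel of the projection -/

/-- The kernel from which the projection is built. Its `i`-th component, evaluated at the relative
signs of `x` and `y`, is up to a constant factor the potential at `y` when a unit current enters the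
cube at `x` and leaves it at `cubeFlip i x`. The integrand is, up to normalization, the heat kernel
of the cube at time `t` with the factor of the coordinate `i` removed, where `r = exp (-2 * t)`. -/
noncomputable def cubeKernel {n : ℕ} (m : Fin n → ℝ) (i : Fin n) : ℝ :=
  m i * ∫ r in (0 : ℝ)..1, ∏ k ∈ Finset.univ.erase i, (1 + m k * r)

/-- The integrands sum to the derivative of `r ↦ ∏ k, (1 + m k * r)`. -/
theorem sum_cubeKernel {n : ℕ} (m : Fin n → ℝ) :
    ∑ i, cubeKernel m i = ∏ k, (1 + m k) - 1 := by
  have hd : ∀ r ∈ Set.uIcc (0 : ℝ) 1, HasDerivAt (fun r : ℝ => ∏ k, (1 + m k * r))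
      (∑ i, (∏ k ∈ Finset.univ.erase i, (1 + m k * r)) • m i) r := by
    intro r _
    refine HasDerivAt.fun_finsetProd fun i _ => ?_
    simpa using ((hasDerivAt_id r).const_mul (m i)).const_add 1
  have hi : IntervalIntegrable
      (fun r : ℝ => ∑ i, (∏ k ∈ Finset.univ.erase i, (1 + m k * r)) • m i)
      MeasureTheory.volume 0 1 := by
    apply Continuous.intervalIntegrable
    fun_prop
  have h := intervalIntegral.integral_eq_sub_of_hasDerivAt hd hi
  rw [intervalIntegral.integral_finsetSum (fun i _ => by
    apply Continuous.intervalIntegrable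
    fun_prop)] at h
  simp only [smul_eq_mul, intervalIntegral.integral_mul_const] at h
  simp only [cubeKernel, mul_comm (m _)]
  simpa [mul_comm] using h

theorem cubeKernel_update_self {n : ℕ} (m : Fin n → ℝ) (i : Fin n) :
    cubeKernel (Function.update m i (-m i)) i = -cubeKernel m i := by
  unfold cubeKernel
  have : ∀ r : ℝ, ∏ k ∈ Finset.univ.erase i, (1 + Function.update m i (-m i) k * r) =
      ∏ k ∈ Finset.univ.erase i, (1 + m k * r) := fun r =>
    Finset.prod_congr rfl fun k hk => by rw [Function.update_of_ne (Finset.ne_of_mem_erase hk)]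
  simp only [this, Function.update_self, neg_mul]

theorem cubeKernel_sub_update {n : ℕ} (m : Fin n → ℝ) {i j : Fin n} (hij : j ≠ i) :
    cubeKernel m i - cubeKernel (Function.update m j (-m j)) i =
      m i * (m j * ∫ r in (0 : ℝ)..1,
        2 * r * ∏ k ∈ (Finset.univ.erase i).erase j, (1 + m k * r)) := by
  unfold cubeKernel
  rw [Function.update_of_ne hij.symm, ← mul_sub, ← intervalIntegral.integral_sub,
    ← intervalIntegral.integral_const_mul (m j)]
  · congr 2
    funext r
    have hj : j ∈ Finset.univ.erase i := Finset.mem_erase.2 ⟨hij, Finset.mem_univ j⟩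
    have hu : ∏ k ∈ (Finset.univ.erase i).erase j, (1 + Function.update m j (-m j) k * r) =
        ∏ k ∈ (Finset.univ.erase i).erase j, (1 + m k * r) :=
      Finset.prod_congr rfl fun k hk => by rw [Function.update_of_ne (Finset.ne_of_mem_erase hk)]
    rw [← Finset.mul_prod_erase _ _ hj, ← Finset.mul_prod_erase _ _ hj, Function.update_self, hu]
    ring
  all_goals
    apply Continuous.intervalIntegrable
    fun_prop

theorem prod_one_add_mul_nonneg {n : ℕ} {m : Fin n → ℝ} (hm : ∀ k, |m k| = 1)
    (A : Finset (Fin n)) {r : ℝ} (hr : r ∈ Set.Icc (0 : ℝ) 1) : 0 ≤ ∏ k ∈ A, (1 + m k * r) := by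
  refine Finset.prod_nonneg fun k _ => ?_
  have h1 : |m k * r| ≤ 1 := by
    rw [abs_mul, hm, one_mul, abs_of_nonneg hr.1]
    exact hr.2
  linarith [neg_abs_le (m k * r)]

/-- The integrals over `r` can be evaluated after summation over the cube because all integrands
are nonnegative. -/
theorem sum_abs_cubeKernel_sub {n : ℕ} (i j : Fin n) (y : HammingCube n) :
    ∑ x, |cubeKernel (relSign x y) i - cubeKernel (relSign x (cubeFlip j y)) i| =
      2 ^ n * (if j = i then 2 else 1) := by
  simp only [relSign_cubeFlip_right]
  split_ifs with hij
  · subst hij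
    have h : ∀ x : HammingCube n, |cubeKernel (relSign x y) j -
        cubeKernel (Function.update (relSign x y) j (-relSign x y j)) j| =
        2 * ∫ r in (0 : ℝ)..1, ∏ k ∈ Finset.univ.erase j, (1 + relSign x y k * r) := by
      intro x
      rw [cubeKernel_update_self, cubeKernel, sub_neg_eq_add, ← two_mul, abs_mul, abs_mul,
        abs_relSign, one_mul, abs_two, abs_of_nonneg]
      exact intervalIntegral.integral_nonneg zero_le_one fun r hr =>
        prod_one_add_mul_nonneg (abs_relSign x y) _ hr
    simp only [h]
    rw [← Finset.mul_sum, ← intervalIntegral.integral_finsetSum (fun i _ => by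
      apply Continuous.intervalIntegrable
      fun_prop)]
    simp only [sum_prod_one_add_relSign_mul]
    simp [mul_comm]
  · have h : ∀ x : HammingCube n, |cubeKernel (relSign x y) i -
        cubeKernel (Function.update (relSign x y) j (-relSign x y j)) i| =
        ∫ r in (0 : ℝ)..1,
          2 * r * ∏ k ∈ (Finset.univ.erase i).erase j, (1 + relSign x y k * r) := by
      intro x
      rw [cubeKernel_sub_update _ hij, abs_mul, abs_mul, abs_relSign, abs_relSign, one_mul,
        one_mul, abs_of_nonneg]
      exact intervalIntegral.integral_nonneg zero_le_one fun r hr =>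
        mul_nonneg (mul_nonneg zero_le_two hr.1) (prod_one_add_mul_nonneg (abs_relSign x y) _ hr)
    simp only [h]
    rw [← intervalIntegral.integral_finsetSum (fun i _ => by
      apply Continuous.intervalIntegrable
      fun_prop)]
    simp only [← Finset.mul_sum, sum_prod_one_add_relSign_mul]
    rw [intervalIntegral.integral_mul_const, intervalIntegral.integral_const_mul, integral_id]
    ring

/-! ### Injectivity and projection constants -/

/-- The Hahn–Banach theorem for a functional on a space embedded isometrically by `u`. -/
theorem LinearIsometry.exists_dual_extension {Y Z : Type*} [NormedAddCommGroup Y]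
    [NormedSpace ℝ Y] [NormedAddCommGroup Z] [NormedSpace ℝ Z] (u : Y →ₗᵢ[ℝ] Z) (f : Y →ₗ[ℝ] ℝ)
    (hf : ∀ y, |f y| ≤ ‖y‖) :
    ∃ g : Z →ₗ[ℝ] ℝ, (∀ y, g (u y) = f y) ∧ ∀ z, |g z| ≤ ‖z‖ := by
  let f' : StrongDual ℝ (LinearMap.range u.toLinearMap) :=
    (f ∘ₗ u.equivRange.symm.toLinearEquiv.toLinearMap).mkContinuous 1 fun z => by
      simpa using hf (u.equivRange.symm z)
  obtain ⟨g, hg, hn⟩ := exists_extension_norm_eq _ f'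
  refine ⟨g, fun y => ?_, fun z => ?_⟩
  · have h := hg (u.equivRange y)
    simpa [f'] using h
  · have h1 : ‖g‖ ≤ 1 := hn.trans_le (LinearMap.mkContinuous_norm_le _ zero_le_one _)
    simpa using g.le_of_opNorm_le h1 z

/-- The linear map into `ℓ_∞` with prescribed coordinate functionals of norm at most `1`. -/
def EllInfty.ofCoords {Z : Type*} [NormedAddCommGroup Z] [NormedSpace ℝ Z] (g : ℕ → Z →ₗ[ℝ] ℝ)
    (hg : ∀ k z, |g k z| ≤ ‖z‖) : Z →ₗ[ℝ] EllInfty where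
  toFun z := ⟨fun k => g k z, memℓp_infty ⟨‖z‖, by rintro _ ⟨k, rfl⟩; exact hg k z⟩⟩
  map_add' a b := by ext k; exact (g k).map_add a b
  map_smul' c a := by ext k; exact (g k).map_smul c a

theorem EllInfty.ofCoords_apply {Z : Type*} [NormedAddCommGroup Z] [NormedSpace ℝ Z]
    (g : ℕ → Z →ₗ[ℝ] ℝ) (hg : ∀ k z, |g k z| ≤ ‖z‖) (z : Z) (k : ℕ) :
    EllInfty.ofCoords g hg z k = g k z := rfl

theorem EllInfty.norm_ofCoords_le {Z : Type*} [NormedAddCommGroup Z] [NormedSpace ℝ Z]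
    (g : ℕ → Z →ₗ[ℝ] ℝ) (hg : ∀ k z, |g k z| ≤ ‖z‖) (z : Z) :
    ‖EllInfty.ofCoords g hg z‖ ≤ ‖z‖ :=
  lp.norm_le_of_forall_le (norm_nonneg z) fun k => hg k z

theorem EllInfty.abs_apply_le_norm (a : EllInfty) (k : ℕ) : |a k| ≤ ‖a‖ :=
  lp.norm_apply_le_norm ENNReal.top_ne_zero a k

/-- `ℓ_∞` is a `1`-injective space. -/
theorem LinearIsometry.exists_ellInfty_extension {Y Z : Type*} [NormedAddCommGroup Y]
    [NormedSpace ℝ Y] [NormedAddCommGroup Z] [NormedSpace ℝ Z] (u : Y →ₗᵢ[ℝ] Z)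
    (w : Y →ₗᵢ[ℝ] EllInfty) :
    ∃ B : Z →ₗ[ℝ] EllInfty, (∀ y, B (u y) = w y) ∧ ∀ z, ‖B z‖ ≤ ‖z‖ := by
  have h : ∀ k : ℕ, ∃ g : Z →ₗ[ℝ] ℝ, (∀ y, g (u y) = w y k) ∧ ∀ z, |g z| ≤ ‖z‖ := fun k =>
    u.exists_dual_extension
      { toFun := fun y => w y k
        map_add' := fun a b => by simp
        map_smul' := fun c a => by simp } fun y => by
      simpa using EllInfty.abs_apply_le_norm (w y) k
  choose g hg hb using h
  refine ⟨EllInfty.ofCoords g hb, fun y => ?_, EllInfty.norm_ofCoords_le g hb⟩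
  ext k
  exact hg k y

/-- A finite power of `ℝ` with the maximum norm is a `1`-injective space. -/
theorem LinearIsometry.exists_pi_extension {Y Z E : Type*} [Fintype E] [NormedAddCommGroup Y]
    [NormedSpace ℝ Y] [NormedAddCommGroup Z] [NormedSpace ℝ Z] (u : Y →ₗᵢ[ℝ] Z)
    (w : Y →ₗᵢ[ℝ] (E → ℝ)) :
    ∃ A : Z →ₗ[ℝ] (E → ℝ), (∀ y, A (u y) = w y) ∧ ∀ z, ‖A z‖ ≤ ‖z‖ := by
  have h : ∀ e : E, ∃ g : Z →ₗ[ℝ] ℝ, (∀ y, g (u y) = w y e) ∧ ∀ z, |g z| ≤ ‖z‖ := fun e =>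
    u.exists_dual_extension (LinearMap.proj e ∘ₗ w.toLinearMap) fun y => by
      simpa using norm_le_pi_norm (w y) e
  choose g hg hb using h
  refine ⟨LinearMap.pi g, fun y => funext fun e => hg e y, fun z => ?_⟩
  exact (pi_norm_le_iff_of_nonneg (norm_nonneg z)).2 fun e => hb e z

/-- A finite power of `ℝ` with the maximum norm embeds isometrically into `ℓ_∞`, by
composition with a surjection from `ℕ` onto the index set. -/
theorem exists_linearIsometry_ellInfty (E : Type*) [Fintype E] [Nonempty E] :
    Nonempty ((E → ℝ) →ₗᵢ[ℝ] EllInfty) := by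
  obtain ⟨e, he⟩ := exists_surjective_nat E
  have hb : ∀ (k : ℕ) (z : E → ℝ), |LinearMap.proj (R := ℝ) (φ := fun _ : E => ℝ) (e k) z| ≤ ‖z‖ :=
    fun k z => norm_le_pi_norm z (e k)
  refine ⟨⟨EllInfty.ofCoords _ hb, fun z => le_antisymm (EllInfty.norm_ofCoords_le _ hb z) ?_⟩⟩
  refine (pi_norm_le_iff_of_nonneg (norm_nonneg _)).2 fun a => ?_
  obtain ⟨k, rfl⟩ := he a
  exact EllInfty.abs_apply_le_norm (EllInfty.ofCoords _ hb z) k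

/-- The projection constant can be computed from any one isometric embedding `D` into a finite
power of `ℝ` with the maximum norm, as the least norm of a left inverse of `D`. -/
theorem hasProjectionConstant_of_leftInverse {Y E : Type*} [NormedAddCommGroup Y]
    [NormedSpace ℝ Y] [Fintype E] [Nonempty E] (D : Y →ₗᵢ[ℝ] (E → ℝ)) {c : ℝ} (hc : 0 ≤ c)
    (hupper : ∃ Q : (E → ℝ) →ₗ[ℝ] Y, (∀ y, Q (D y) = y) ∧ ∀ g, ‖Q g‖ ≤ c * ‖g‖)
    (hlower : ∀ (Q : (E → ℝ) →ₗ[ℝ] Y) (b : ℝ), (∀ y, Q (D y) = y) → (∀ g, ‖Q g‖ ≤ b * ‖g‖) →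
      c ≤ b) :
    HasProjectionConstant Y c := by
  obtain ⟨v⟩ := exists_linearIsometry_ellInfty E
  refine ⟨⟨_, ⟨(v.comp D).equivRange⟩⟩, ?_⟩
  rintro Y₁ ⟨u⟩
  let w : Y →ₗᵢ[ℝ] EllInfty := Y₁.subtypeₗᵢ.comp u.toLinearIsometry
  constructor
  · rintro _ ⟨P, ⟨hP, hr⟩, rfl⟩
    obtain ⟨B, hB, hBn⟩ := D.exists_ellInfty_extension w
    have hmem : ∀ a, P a ∈ Y₁ := fun a => by
      rw [← hr]
      exact ⟨a, rfl⟩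
    have hfix : ∀ a ∈ Y₁, P a = a := by
      intro a ha
      rw [← hr] at ha
      obtain ⟨b, rfl⟩ := ha
      exact DFunLike.congr_fun hP b
    let Q : (E → ℝ) →ₗ[ℝ] Y := u.symm.toLinearEquiv.toLinearMap ∘ₗ
      LinearMap.codRestrict Y₁ ((P : EllInfty →ₗ[ℝ] EllInfty) ∘ₗ B) fun g => hmem _
    have hQ : ∀ g, Q g = u.symm ⟨P (B g), hmem _⟩ := fun g => rfl
    refine hlower Q ‖P‖ (fun y => ?_) fun g => ?_
    · rw [hQ, LinearIsometryEquiv.symm_apply_eq]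
      refine Subtype.ext ?_
      change P (B (D y)) = u y
      rw [hB]
      exact hfix _ (u y).2
    · rw [hQ, LinearIsometryEquiv.norm_map]
      exact (P.le_opNorm _).trans (mul_le_mul_of_nonneg_left (hBn g) (norm_nonneg P))
  · intro b hb
    obtain ⟨Q, hQD, hQn⟩ := hupper
    obtain ⟨A, hA, hAn⟩ := w.exists_pi_extension D
    let P : EllInfty →L[ℝ] EllInfty := (w.toLinearMap ∘ₗ Q ∘ₗ A).mkContinuous c fun a => by
      change ‖w (Q (A a))‖ ≤ _
      rw [w.norm_map]
      exact (hQn _).trans (mul_le_mul_of_nonneg_left (hAn a) hc)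
    have hP : ∀ a, P a = w (Q (A a)) := fun a => rfl
    have hPw : ∀ y, P (w y) = w y := fun y => by rw [hP, hA, hQD]
    refine (hb ⟨P, ⟨?_, ?_⟩, rfl⟩).trans (LinearMap.mkContinuous_norm_le _ hc _)
    · ext1 a
      change P (P a) = P a
      rw [hP a, hPw]
    · ext a
      constructor
      · rintro ⟨a, rfl⟩
        exact (u (Q (A a))).2
      · intro ha
        refine ⟨a, ?_⟩
        have h := hPw (u.symm ⟨a, ha⟩)
        have h2 : w (u.symm ⟨a, ha⟩) = a := by
          change ((u (u.symm ⟨a, ha⟩) : Y₁) : EllInfty) = a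
          rw [u.apply_symm_apply]
        rwa [h2] at h

/-! ### The gradient embedding -/

/-- The element of `Lip₀` of the cube that differs from a given function by a constant. -/
noncomputable def LipZero.ofFun {n : ℕ} (O : HammingCube n) :
    (HammingCube n → ℝ) →ₗ[ℝ] LipZero (HammingCube n) O where
  toFun f := ⟨fun x => f x - f O, by
    refine ⟨⟨⟨∑ e : Fin n × HammingCube n, |f e.2 - f (cubeFlip e.1 e.2)|,
      Finset.sum_nonneg fun _ _ => abs_nonneg _⟩, LipschitzWith.of_dist_le_mul fun x y => ?_⟩,
      sub_self _⟩
    rw [Real.dist_eq, sub_sub_sub_cancel_right]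
    exact abs_sub_le_of_cubeFlip (fun i x =>
      Finset.single_le_sum (f := fun e : Fin n × HammingCube n => |f e.2 - f (cubeFlip e.1 e.2)|)
        (fun _ _ => abs_nonneg _) (Finset.mem_univ (i, x))) x y⟩
  map_add' f g := Subtype.ext <| funext fun x => add_sub_add_comm (f x) (g x) (f O) (g O)
  map_smul' c f := Subtype.ext <| funext fun x => (mul_sub c (f x) (f O)).symm

theorem LipZero.ofFun_toFun {n : ℕ} (O : HammingCube n) (f : HammingCube n → ℝ)
    (x : HammingCube n) : (LipZero.ofFun O f).toFun x = f x - f O := rfl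

/-- Evaluation at a point, as a linear functional on `Lip₀`. -/
def LipZero.eval {X : Type*} [MetricSpace X] {O : X} (x : X) : LipZero X O →ₗ[ℝ] ℝ where
  toFun f := f.toFun x
  map_add' f g := toFun_add f g x
  map_smul' c f := toFun_smul c f x

theorem LipZero.eval_apply {X : Type*} [MetricSpace X] {O : X} (x : X) (f : LipZero X O) :
    LipZero.eval x f = f.toFun x := rfl

/-- The discrete gradient, an isometric embedding of `Lip₀` of the cube into the space of functions
on the directed edges. The pair `(i, x)` stands for the edge from `x` to `cubeFlip i x`. -/
noncomputable def edgeDiff {n : ℕ} (O : HammingCube n) :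
    LipZero (HammingCube n) O →ₗᵢ[ℝ] (Fin n × HammingCube n → ℝ) where
  toLinearMap := LinearMap.pi fun e => LipZero.eval e.2 - LipZero.eval (cubeFlip e.1 e.2)
  norm_map' f := by
    refine le_antisymm ?_ ?_
    · refine (pi_norm_le_iff_of_nonneg (norm_nonneg f)).2 fun e => ?_
      have h := f.abs_sub_le e.2 (cubeFlip e.1 e.2)
      rwa [dist_cubeFlip, mul_one] at h
    · exact f.norm_le (norm_nonneg _) (abs_sub_le_of_cubeFlip fun i x =>
        norm_le_pi_norm (LinearMap.pi (fun e : Fin n × HammingCube n =>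
          LipZero.eval e.2 - LipZero.eval (cubeFlip e.1 e.2)) f) (i, x))

theorem edgeDiff_apply {n : ℕ} {O : HammingCube n} (f : LipZero (HammingCube n) O) (i : Fin n)
    (x : HammingCube n) : edgeDiff O f (i, x) = f.toFun x - f.toFun (cubeFlip i x) := rfl

/-! ### The upper bound -/

/-- A left inverse of `edgeDiff`; it solves the Poisson equation on the cube. -/
noncomputable def edgePotential {n : ℕ} (O : HammingCube n) :
    (Fin n × HammingCube n → ℝ) →ₗ[ℝ] LipZero (HammingCube n) O :=
  LipZero.ofFun O ∘ₗ LinearMap.pi fun y => (2 ^ (n + 1) : ℝ)⁻¹ •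
    ∑ e : Fin n × HammingCube n, cubeKernel (relSign e.2 y) e.1 • LinearMap.proj e

theorem edgePotential_eq {n : ℕ} (O : HammingCube n) (g : Fin n × HammingCube n → ℝ) :
    edgePotential O g = LipZero.ofFun O fun y => (2 ^ (n + 1) : ℝ)⁻¹ *
      ∑ i, ∑ x, cubeKernel (relSign x y) i * g (i, x) := by
  unfold edgePotential
  rw [LinearMap.comp_apply]
  congr 1
  funext y
  simp [LinearMap.sum_apply, Fintype.sum_prod_type]

theorem edgePotential_edgeDiff {n : ℕ} {O : HammingCube n} (f : LipZero (HammingCube n) O) :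
    edgePotential O (edgeDiff O f) = f := by
  have key : ∀ y, (2 ^ (n + 1) : ℝ)⁻¹ *
      ∑ i, ∑ x, cubeKernel (relSign x y) i * edgeDiff O f (i, x) =
        f.toFun y - (2 ^ n : ℝ)⁻¹ * ∑ x, f.toFun x := by
    intro y
    have h1 : ∀ i, ∑ x, cubeKernel (relSign x y) i * edgeDiff O f (i, x) =
        ∑ x, 2 * f.toFun x * cubeKernel (relSign x y) i := by
      intro i
      have h2 : ∑ x, cubeKernel (relSign x y) i * f.toFun (cubeFlip i x) =
          -∑ x, cubeKernel (relSign x y) i * f.toFun x := by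
        rw [← Equiv.sum_comp (cubeFlip i), ← Finset.sum_neg_distrib]
        refine Finset.sum_congr rfl fun x _ => ?_
        rw [cubeFlip_cubeFlip, relSign_cubeFlip_left, cubeKernel_update_self, neg_mul]
      simp only [edgeDiff_apply, mul_sub, Finset.sum_sub_distrib, h2]
      rw [sub_neg_eq_add, ← Finset.sum_add_distrib]
      exact Finset.sum_congr rfl fun x _ => by ring
    simp only [h1]
    rw [Finset.sum_comm]
    simp only [← Finset.mul_sum, sum_cubeKernel, prod_one_add_relSign]
    simp only [mul_sub, Finset.sum_sub_distrib, mul_ite, mul_zero, mul_one, Finset.sum_ite_eq',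
      Finset.mem_univ, if_true, ← Finset.mul_sum]
    field_simp
    ring
  rw [edgePotential_eq]
  simp only [key]
  refine Subtype.ext (funext fun x => ?_)
  change f.toFun x - _ - (f.toFun O - _) = f.toFun x
  rw [f.toFun_base]
  ring

theorem norm_edgePotential_le {n : ℕ} (O : HammingCube n) (g : Fin n × HammingCube n → ℝ) :
    ‖edgePotential O g‖ ≤ ((n : ℝ) + 1) / 2 * ‖g‖ := by
  refine LipZero.norm_le _ (by positivity) (abs_sub_le_of_cubeFlip fun j y => ?_)
  rw [edgePotential_eq, LipZero.ofFun_toFun, LipZero.ofFun_toFun, sub_sub_sub_cancel_right,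
    ← mul_sub, abs_mul, abs_of_pos (by positivity)]
  have h1 : |∑ i, ∑ x, cubeKernel (relSign x y) i * g (i, x) -
      ∑ i, ∑ x, cubeKernel (relSign x (cubeFlip j y)) i * g (i, x)| ≤
      ∑ i, ∑ x, |cubeKernel (relSign x y) i - cubeKernel (relSign x (cubeFlip j y)) i| * ‖g‖ := by
    simp only [← Finset.sum_sub_distrib, ← sub_mul]
    refine (Finset.abs_sum_le_sum_abs _ _).trans (Finset.sum_le_sum fun i _ => ?_)
    refine (Finset.abs_sum_le_sum_abs _ _).trans (Finset.sum_le_sum fun x _ => ?_)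
    rw [abs_mul]
    exact mul_le_mul_of_nonneg_left (norm_le_pi_norm g (i, x)) (abs_nonneg _)
  refine (mul_le_mul_of_nonneg_left h1 (by positivity)).trans_eq ?_
  have h2 : ∑ i : Fin n, (if j = i then 2 else 1 : ℝ) = n + 1 := by
    have : ∀ i : Fin n, (if j = i then 2 else 1 : ℝ) = 1 + if j = i then 1 else 0 := by
      intro i
      split_ifs <;> norm_num
    simp [this, Finset.sum_add_distrib]
  simp only [← Finset.sum_mul, sum_abs_cubeKernel_sub, ← Finset.mul_sum, h2]
  field_simp
  ring

/-! ### The lower bound -/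

/-- The sign pattern of the row, at the edge in direction `j` at `y`, of the projection
`edgeDiff ∘ edgePotential`. -/
def edgeSign {n : ℕ} (j : Fin n) (y : HammingCube n) (e : Fin n × HammingCube n) : ℝ :=
  if e.1 = j then relSign e.2 y j else relSign e.2 y e.1 * relSign e.2 y j

theorem norm_edgeSign {n : ℕ} (j : Fin n) (y : HammingCube n) : ‖edgeSign j y‖ = 1 := by
  refine le_antisymm ((pi_norm_le_iff_of_nonneg zero_le_one).2 fun e => ?_) ?_
  · rw [Real.norm_eq_abs, edgeSign]
    split_ifs <;> simp [abs_mul, abs_relSign]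
  · simpa [edgeSign, relSign_self] using norm_le_pi_norm (edgeSign j y) (j, y)

theorem edgeSign_cubeFlip {n : ℕ} (j : Fin n) (y : HammingCube n) :
    edgeSign j (cubeFlip j y) = -edgeSign j y := by
  funext e
  simp only [edgeSign, Pi.neg_apply, relSign_cubeFlip_right, Function.update_self]
  split_ifs with h
  · rfl
  · rw [Function.update_of_ne h, mul_neg]

/-- Up to a constant, twice the sum of the characters of weight `1` and `2` of the cube,
translated by `y`. -/
noncomputable def signPotential {n : ℕ} (y x : HammingCube n) : ℝ :=
  2 * (∑ k, relSign x y k) + (∑ k, relSign x y k) ^ 2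

theorem signPotential_sub_cubeFlip {n : ℕ} (y x : HammingCube n) (i : Fin n) :
    signPotential y x - signPotential y (cubeFlip i x) = 4 * ∑ j, edgeSign j y (i, x) := by
  have h1 : ∑ k, relSign (cubeFlip i x) y k = (∑ k, relSign x y k) - 2 * relSign x y i := by
    rw [relSign_cubeFlip_left, Finset.sum_update_of_mem (Finset.mem_univ i),
      ← Finset.add_sum_erase _ _ (Finset.mem_univ i), Finset.sdiff_singleton_eq_erase]
    ring
  have h2 : ∀ j, edgeSign j y (i, x) =
      relSign x y i * relSign x y j + if i = j then relSign x y i - 1 else 0 := by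
    intro j
    unfold edgeSign
    split_ifs with h
    · dsimp only at h
      subst h
      rw [relSign_mul_self]
      ring
    · rw [add_zero]
  simp only [h2, Finset.sum_add_distrib, ← Finset.mul_sum, signPotential, h1]
  simp only [Finset.sum_ite_eq, Finset.mem_univ, if_true]
  linear_combination (-4 : ℝ) * relSign_mul_self x y i

/-- The sign patterns of the edges at `y` add up to a gradient, which every left inverse of
`edgeDiff` integrates in the same way. -/
theorem sum_edgeSign_eq {n : ℕ} (O y : HammingCube n) :
    ∑ j, edgeSign j y = (4 : ℝ)⁻¹ • edgeDiff O (LipZero.ofFun O (signPotential y)) := by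
  funext ⟨i, x⟩
  rw [Pi.smul_apply, edgeDiff_apply, LipZero.ofFun_toFun, LipZero.ofFun_toFun,
    sub_sub_sub_cancel_right, signPotential_sub_cubeFlip, Finset.sum_apply, smul_eq_mul]
  ring

theorem sum_relSign_mul_relSign {n : ℕ} (y : HammingCube n) (k l : Fin n) :
    ∑ x, relSign x y k * relSign x y l = if k = l then 2 ^ n else 0 := by
  split_ifs with h
  · subst h
    simp [relSign_mul_self, card_hammingCube]
  · refine sum_eq_zero_of_cubeFlip k fun x => ?_
    rw [relSign_cubeFlip_left, Function.update_self, Function.update_of_ne (Ne.symm h), neg_mul]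

theorem sum_signPotential {n : ℕ} (O : HammingCube n) :
    ∑ y, signPotential y O = n * 2 ^ n := by
  have h1 : ∀ k, ∑ x, relSign x O k = 0 := fun k => sum_eq_zero_of_cubeFlip k fun x => by
    rw [relSign_cubeFlip_left, Function.update_self]
  have h2 : ∑ x, (∑ k, relSign x O k) ^ 2 = n * 2 ^ n := by
    simp only [sq, Finset.sum_mul_sum]
    rw [Finset.sum_comm, Finset.sum_congr rfl fun k _ => Finset.sum_comm]
    simp [sum_relSign_mul_relSign]
  simp only [signPotential, relSign_comm O, Finset.sum_add_distrib, ← Finset.mul_sum, h2]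
  rw [Finset.sum_comm]
  simp [h1]

theorem signPotential_self {n : ℕ} (y : HammingCube n) :
    signPotential y y = 2 * n + (n : ℝ) ^ 2 := by
  simp [signPotential, relSign_self]

/-- Evaluates the trace of `edgeDiff ∘ Q ∘ S`, where the columns of `S` are the sign patterns; it
is the same for all left inverses `Q` of `edgeDiff`. -/
theorem sum_edgeDiff_edgeSign {n : ℕ} {O : HammingCube n}
    (Q : (Fin n × HammingCube n → ℝ) →ₗ[ℝ] LipZero (HammingCube n) O)
    (hQ : ∀ f, Q (edgeDiff O f) = f) :
    ∑ j, ∑ y, edgeDiff O (Q (edgeSign j y)) (j, y) = n * 2 ^ n * (((n : ℝ) + 1) / 2) := by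
  have h1 : ∀ j, ∑ y, edgeDiff O (Q (edgeSign j y)) (j, y) =
      ∑ y, 2 * (Q (edgeSign j y)).toFun y := by
    intro j
    have h2 : ∑ y, (Q (edgeSign j y)).toFun (cubeFlip j y) =
        -∑ y, (Q (edgeSign j y)).toFun y := by
      rw [← Equiv.sum_comp (cubeFlip j), ← Finset.sum_neg_distrib]
      refine Finset.sum_congr rfl fun y _ => ?_
      rw [cubeFlip_cubeFlip, edgeSign_cubeFlip, map_neg, ← LipZero.eval_apply, map_neg,
        LipZero.eval_apply]
    simp only [edgeDiff_apply, Finset.sum_sub_distrib, h2, ← Finset.mul_sum]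
    ring
  have h3 : ∀ y, ∑ j, 2 * (Q (edgeSign j y)).toFun y =
      2⁻¹ * (signPotential y y - signPotential y O) := by
    intro y
    simp only [← LipZero.eval_apply]
    rw [← Finset.mul_sum, ← map_sum, ← map_sum, sum_edgeSign_eq O y, map_smul, hQ, map_smul,
      LipZero.eval_apply, LipZero.ofFun_toFun, smul_eq_mul]
    ring
  simp only [h1]
  rw [Finset.sum_comm]
  simp only [h3, ← Finset.mul_sum, Finset.sum_sub_distrib, signPotential_self, sum_signPotential]
  rw [Finset.sum_const, Finset.card_univ, card_hammingCube, nsmul_eq_mul]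
  push_cast
  ring

theorem le_of_leftInverse_edgeDiff {n : ℕ} (hn : 1 ≤ n) {O : HammingCube n}
    (Q : (Fin n × HammingCube n → ℝ) →ₗ[ℝ] LipZero (HammingCube n) O) (b : ℝ)
    (hQ : ∀ f, Q (edgeDiff O f) = f) (hb : ∀ g, ‖Q g‖ ≤ b * ‖g‖) : ((n : ℝ) + 1) / 2 ≤ b := by
  have hn0 : (0 : ℝ) < n := by exact_mod_cast hn
  have h1 : ∀ (j : Fin n) (y : HammingCube n),
      edgeDiff O (Q (edgeSign j y)) (j, y) ≤ ‖Q (edgeSign j y)‖ := by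
    intro j y
    rw [← (edgeDiff O).norm_map]
    exact (le_abs_self _).trans (norm_le_pi_norm (edgeDiff O (Q (edgeSign j y))) (j, y))
  have h2 : ∑ j : Fin n, ∑ y, edgeDiff O (Q (edgeSign j y)) (j, y) ≤
      ∑ j : Fin n, ∑ y : HammingCube n, b :=
    Finset.sum_le_sum fun j _ => Finset.sum_le_sum fun y _ => (h1 j y).trans (by
      simpa [norm_edgeSign] using hb (edgeSign j y))
  rw [sum_edgeDiff_edgeSign Q hQ] at h2
  simp only [Finset.sum_const, Finset.card_univ, card_hammingCube, Fintype.card_fin,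
    nsmul_eq_mul] at h2
  push_cast at h2
  rw [← mul_assoc] at h2
  exact le_of_mul_le_mul_left h2 (by positivity)

/-! ### The projection constant of `Lip₀` of the cube -/

theorem mainTheorem1 (n : ℕ) (hn : 1 ≤ n) (O : HammingCube n) :
    HasProjectionConstant (LipZero (HammingCube n) O) (((n : ℝ) + 1) / 2) := by
  have : Nonempty (Fin n) := ⟨⟨0, hn⟩⟩
  have : Nonempty (HammingCube n) := ⟨O⟩
  exact hasProjectionConstant_of_leftInverse (edgeDiff O) (by positivity)
    ⟨edgePotential O, edgePotential_edgeDiff, norm_edgePotential_le O⟩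
    (le_of_leftInverse_edgeDiff hn)
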